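/- Let $2\le q<\infty$ and let $\mathcal B$ be a (real or complex) Banach space. For $f\in L^p(\mathbb R;\mathcal B)$, $t>0$ and $x\in\mathbb R$ put $$A_tf(x)=\frac1{2t}\int_{-t}^{t}f(x+y)\,dy,\qquad \mathcal V_q(A)f(x)=\sup_{0<t_0\le t_1\le t_2\le\cdots}\Big(\|A_{t_0}f(x)\|^q+\sum_{k\ge1}\|A_{t_k}f(x)-A_{t_{k-1}}f(x)\|^q\Big)^{1/q}\in[0,\infty].$$ Suppose that there exist $1<p<\infty$ and a finite constant $C$ such that $$\|\mathcal V_q(A)f\|_{L^p(\mathbb R)}\le C\,\|f\|_{L^p(\mathbb R;\mathcal B)}\qquad\text{for all } f\in L^p(\mathbb R;\mathcal B).$$ Then $\mathcal B$ has Rademacher cotype $q$: there is a finite constant $C'$ such that for all $n\ge0$ and all $x_1,\dots,x_n\in\mathcal B$ $$\Big(\sum_{k=1}^n\|x_k\|^q\Big)^{1/q}\le C'\,\Big(2^{-n}\sum_{\varepsilon\in\{-1,1\}^n}\Big\|\sum_{k=1}^n\varepsilon_kx_k\Big\|^q\Big)^{1/q}.$$ -/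

import Mathlib

open MeasureTheory
open scoped ENNReal NNReal

/-- The `q`-variation norm `‖(a_t)_{t > 0}‖_{V_q(B)}`, with values in `[0, ∞]`: the supremum of
`(‖a_{t_0}‖ ^ q + ∑_{k ≥ 1} ‖a_{t_k} - a_{t_{k-1}}‖ ^ q) ^ (1 / q)` over all increasing sequences
`(t_k)_{k ≥ 0}` of positive real numbers. Only the values `a t` with `t > 0` matter. (Sequences may
repeat values; the repetitions contribute `0`, so that the supremum is the same as over strictly
increasing ones, or over finite ones.) -/
noncomputable def qVariation {B : Type*} [NormedAddCommGroup B] (q : ℝ) (a : ℝ → B) : ℝ≥0∞ :=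
  ⨆ (t : ℕ → ℝ) (_ : Monotone t) (_ : ∀ k, 0 < t k),
    (‖a (t 0)‖ₑ ^ q + ∑' k : ℕ, ‖a (t (k + 1)) - a (t k)‖ₑ ^ q) ^ (1 / q)

/-- The interval averages `A_t f (x) = (2 t)⁻¹ ∫_{(-t, t)} f (x + y) dy` on the real line. -/
noncomputable def intervalAvg {B : Type*} [NormedAddCommGroup B] [NormedSpace ℝ B]
    (f : ℝ → B) (t x : ℝ) : B :=
  ⨍ y in Metric.ball (0 : ℝ) t, f (x + y)

/-- `B` has Rademacher cotype `q`: there is a constant `C` such that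
`(∑ ‖x_k‖ ^ q) ^ (1 / q) ≤ C (𝔼 ‖∑ ε_k x_k‖ ^ q) ^ (1 / q)` for all finite families in `B`, where
`ε_1, …, ε_n` are independent and uniformly distributed signs, i.e. the expectation is the average
over all `2 ^ n` choices of signs. -/
def HasRademacherCotype (B : Type*) [NormedAddCommGroup B] (q : ℝ) : Prop :=
  ∃ C : ℝ, ∀ (n : ℕ) (x : Fin n → B),
    (∑ k, ‖x k‖ ^ q) ^ (1 / q) ≤
      C * ((∑ ε : Fin n → ℤˣ, ‖∑ k, (ε k : ℤ) • x k‖ ^ q) / 2 ^ n) ^ (1 / q)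

/-!
Write `u(x) = ±1` for the sign that is `1` exactly when `x` has fractional part `< 1 / 2`, and let
`M = 2 m` be a large even integer. The functions `u(M ^ j x)`, `j = 0, 1, …`, are independent signs
on `[0, 1]`, and they live on widely separated scales. Given `x_1, …, x_n`, consider on the real
line the function `f(x) = ∑ k, u(M ^ (k - 1) x) x_k`. For most `x`, the signs of the first `k`
terms are constant on the interval of length `M ^ (-k)` centred at `x`, and this length is a full
period of the remaining part of the sum, which has mean zero. Hence the average of
`f` over that interval is *exactly* the `k`-th partial sum, and the variation of the averages at
these scales is `(∑ ‖x_k‖ ^ q) ^ (1 / q)`.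

The hypothesis then bounds this number by an `L ^ p` norm of `∑ ε_k x_k`, whereas an `L ^ q` norm is
wanted. To avoid a comparison of moments, the partial sums are stopped as soon as their norm exceeds
`c = 2 E`, where `E ^ q = 𝔼 ‖∑ ε_k x_k‖ ^ q`. The stopped sum is bounded by `3 E`, since every
`‖x_k‖` is at most `E`; and it stops only with probability at most `2 ^ (-q) ≤ 1 / 4`, by Doob's
maximal inequality for the submartingale of norms. So on a set of measure at least `1 / 2`
nothing is stopped and the averages are exact, and the `L ^ p` bound gives
`(∑ ‖x_k‖ ^ q) ^ (1 / q) ≤ 18 C E`.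

The stopped sum is `stoppedWalk`. The function `defect` dominates the indicator of the set of bad
points. The main steps are `integral_stoppedWalk_window` (the averages are exact),
`norm_stoppedWalk_take_sub` (their increments), `integral_defect_le` (few points are bad), and
`sum_le_of_eLpNorm_qVariation_le`, which combines them.
-/

/-! ### Periodic functions and sign branching -/

lemma periodic_comp_nat_mul {α : Type*} {g : ℝ → α} (hg : Function.Periodic g 1) (k : ℕ) (x : ℝ) :
    g (k * (x + 1)) = g (k * x) := by
  have := hg.nat_mul k (k * x)
  rw [← this]
  congr 1
  ring

section Branch

variable {E : Type*} [NormedAddCommGroup E]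

/-- Bounded, strongly measurable functions of period `1` on the real line: the class in which all
constructions below take place. -/
structure IsBoundedPeriodic (g : ℝ → E) : Prop where
  periodic : Function.Periodic g 1
  stronglyMeasurable : StronglyMeasurable g
  bounded : ∃ C, ∀ x, ‖g x‖ ≤ C

/-- The function that, according to the sign `±1` carried by the half-period in which `x` lies,
continues with `g` or with `h`, rescaled to run through `m` periods on each half-period. -/
noncomputable def branch (m : ℕ) (g h : ℝ → E) (x : ℝ) : E :=
  if Int.fract x < 1 / 2 then g (2 * m * x) else h (2 * m * x)

namespace IsBoundedPeriodic

lemma const (s : E) : IsBoundedPeriodic (fun _ : ℝ => s) :=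
  ⟨fun _ => rfl, stronglyMeasurable_const, ‖s‖, fun _ => le_rfl⟩

lemma add {g h : ℝ → E} (hg : IsBoundedPeriodic g) (hh : IsBoundedPeriodic h) :
    IsBoundedPeriodic (fun x => g x + h x) := by
  obtain ⟨C, hC⟩ := hg.bounded
  obtain ⟨D, hD⟩ := hh.bounded
  exact ⟨fun x => by simp only [hg.periodic x, hh.periodic x],
    hg.stronglyMeasurable.add hh.stronglyMeasurable, C + D,
    fun x => (norm_add_le _ _).trans (add_le_add (hC x) (hD x))⟩

lemma branch {g h : ℝ → E} (hg : IsBoundedPeriodic g) (hh : IsBoundedPeriodic h) (m : ℕ) :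
    IsBoundedPeriodic (branch m g h) := by
  obtain ⟨C, hC⟩ := hg.bounded
  obtain ⟨D, hD⟩ := hh.bounded
  refine ⟨fun x => ?_, ?_, max C D, fun x => ?_⟩
  · have h1 := periodic_comp_nat_mul hg.periodic (2 * m) x
    have h2 := periodic_comp_nat_mul hh.periodic (2 * m) x
    push_cast at h1 h2
    simp only [_root_.branch, Int.fract_add_one, h1, h2]
  · exact StronglyMeasurable.ite (measurableSet_lt measurable_fract measurable_const)
      (hg.stronglyMeasurable.comp_measurable (measurable_const_mul _))
      (hh.stronglyMeasurable.comp_measurable (measurable_const_mul _))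
  · unfold _root_.branch
    split_ifs
    · exact (hC _).trans (le_max_left _ _)
    · exact (hD _).trans (le_max_right _ _)

lemma intervalIntegrable {g : ℝ → E} (hg : IsBoundedPeriodic g) (a b : ℝ) :
    IntervalIntegrable g volume a b := by
  obtain ⟨C, hC⟩ := hg.bounded
  exact (intervalIntegrable_const (c := C)).mono_fun hg.stronglyMeasurable.aestronglyMeasurable
    (ae_of_all _ fun x => (hC x).trans (le_abs_self C))

variable [NormedSpace ℝ E]

lemma integral_nat_mul {g : ℝ → E} (hg : IsBoundedPeriodic g) {k : ℕ} (a : ℝ) :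
    ∫ x in a..a + k, g x = k • ∫ x in (0 : ℝ)..1, g x := by
  have h1 := hg.periodic.intervalIntegral_add_zsmul_eq k a hg.intervalIntegrable
  have h2 := hg.periodic.intervalIntegral_add_eq a 0
  simp only [zsmul_eq_mul, mul_one, Int.cast_natCast, natCast_zsmul, zero_add] at h1 h2
  rw [h1, h2]

/-- Each half-period holds `m` full periods of `g` or of `h`, so the mean of `branch m g h` is the
average of the two means. -/
lemma integral_branch {g h : ℝ → E} (hg : IsBoundedPeriodic g) (hh : IsBoundedPeriodic h)
    {m : ℕ} (hm : 0 < m) :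
    ∫ x in (0 : ℝ)..1, _root_.branch m g h x =
      (1 / 2 : ℝ) • ((∫ x in (0 : ℝ)..1, g x) + ∫ x in (0 : ℝ)..1, h x) := by
  have hm' : (m : ℝ) ≠ 0 := by positivity
  have hm2 : (2 * m : ℝ) ≠ 0 := by positivity
  have hi := (hg.branch hh m).intervalIntegrable
  have h1 : ∫ x in (0 : ℝ)..1 / 2, _root_.branch m g h x =
      (1 / 2 : ℝ) • ∫ x in (0 : ℝ)..1, g x := by
    have : ∫ x in (0 : ℝ)..1 / 2, _root_.branch m g h x =
        ∫ x in (0 : ℝ)..1 / 2, g (2 * m * x) := by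
      refine intervalIntegral.integral_congr_Ioo_of_le (by norm_num) fun x hx => ?_
      have : Int.fract x = x := Int.fract_eq_self.2 ⟨hx.1.le, by linarith [hx.2]⟩
      simp only [_root_.branch, this, if_pos hx.2]
    rw [this, intervalIntegral.integral_comp_mul_left _ hm2]
    have e : (2 * m * (1 / 2) : ℝ) = 2 * m * 0 + m := by ring
    rw [e, hg.integral_nat_mul, ← Nat.cast_smul_eq_nsmul ℝ, smul_smul]
    congr 1
    field_simp
  have h2 : ∫ x in (1 / 2 : ℝ)..1, _root_.branch m g h x =
      (1 / 2 : ℝ) • ∫ x in (0 : ℝ)..1, h x := by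
    have : ∫ x in (1 / 2 : ℝ)..1, _root_.branch m g h x =
        ∫ x in (1 / 2 : ℝ)..1, h (2 * m * x) := by
      refine intervalIntegral.integral_congr_Ioo_of_le (by norm_num) fun x hx => ?_
      have : Int.fract x = x := Int.fract_eq_self.2 ⟨by linarith [hx.1], hx.2⟩
      simp only [_root_.branch, this, if_neg (not_lt.2 hx.1.le)]
    rw [this, intervalIntegral.integral_comp_mul_left _ hm2]
    have e : (2 * m * 1 : ℝ) = 2 * m * (1 / 2) + m := by ring
    rw [e, hh.integral_nat_mul, ← Nat.cast_smul_eq_nsmul ℝ, smul_smul]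
    congr 1
    field_simp
  rw [← intervalIntegral.integral_add_adjacent_intervals (hi 0 (1 / 2)) (hi (1 / 2) 1), h1, h2,
    smul_add]

end IsBoundedPeriodic

lemma fract_lt_half_iff {N : ℤ} {y : ℝ} (h1 : (N : ℝ) ≤ 2 * y) (h2 : 2 * y < N + 1) :
    Int.fract y < 1 / 2 ↔ Even N := by
  rcases Int.even_or_odd' N with ⟨j, rfl | rfl⟩ <;> push_cast at h1 h2
  · have : ⌊y⌋ = j := Int.floor_eq_iff.2 ⟨by linarith, by linarith⟩
    simp only [Int.fract, this, even_two, Even.mul_right, iff_true]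
    linarith
  · have : ⌊y⌋ = j := Int.floor_eq_iff.2 ⟨by linarith, by linarith⟩
    simp only [Int.fract, this, Int.not_even_two_mul_add_one, iff_false, not_lt]
    linarith

/-- Points close to `x` lie in the same half-period as `x`, unless `x` is close to `ℤ / 2`. The
condition says that there is no integer in the interval `(2 x - a, 2 x + a]`. -/
lemma fract_lt_half_congr {a x y : ℝ} (hx : 2 * a ≤ Int.fract (2 * x + a))
    (hy : |y - x| ≤ a / 2) : Int.fract y < 1 / 2 ↔ Int.fract x < 1 / 2 := by
  have ha : 0 ≤ a := by linarith [abs_nonneg (y - x)]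
  have h1 := Int.floor_add_fract (2 * x + a)
  have h2 := Int.fract_lt_one (2 * x + a)
  obtain ⟨h3, h4⟩ := abs_le.1 hy
  rw [fract_lt_half_iff (N := ⌊2 * x + a⌋) (by linarith) (by linarith),
    fract_lt_half_iff (N := ⌊2 * x + a⌋) (by linarith) (by linarith)]

/-- The indicator function of the points `x` for which `(2 x - a, 2 x + a]` contains an integer. -/
noncomputable def nearHalfInteger (a x : ℝ) : ℝ := if Int.fract (2 * x + a) < 2 * a then 1 else 0

lemma isBoundedPeriodic_fract_lt (b : ℝ) :
    IsBoundedPeriodic (fun x : ℝ => if Int.fract x < b then (1 : ℝ) else 0) := by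
  refine ⟨fun x => by simp, ?_, 1, fun x => by split_ifs <;> simp⟩
  exact StronglyMeasurable.ite (measurableSet_lt measurable_fract measurable_const)
    stronglyMeasurable_const stronglyMeasurable_const

lemma isBoundedPeriodic_nearHalfInteger (a : ℝ) : IsBoundedPeriodic (nearHalfInteger a) := by
  refine ⟨fun x => ?_, ?_, 1, fun x => ?_⟩
  · have : 2 * (x + 1) + a = 2 * x + a + (2 : ℕ) := by push_cast; ring
    simp only [nearHalfInteger, this, Int.fract_add_natCast]
  · exact (isBoundedPeriodic_fract_lt (2 * a)).stronglyMeasurable.comp_measurable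
      (g := fun x : ℝ => 2 * x + a) (by fun_prop)
  · unfold nearHalfInteger
    split_ifs <;> simp

lemma integral_nearHalfInteger {a : ℝ} (ha : 0 ≤ a) (ha' : 2 * a ≤ 1) :
    ∫ x in (0 : ℝ)..1, nearHalfInteger a x = 2 * a := by
  set g : ℝ → ℝ := fun x => if Int.fract x < 2 * a then 1 else 0 with hg
  have hn : IsBoundedPeriodic g := isBoundedPeriodic_fract_lt _
  have h0 : ∫ x in (0 : ℝ)..1, nearHalfInteger a x = ∫ x in (0 : ℝ)..1, g (2 * x + a) := rfl
  have e : (2 * 1 + a : ℝ) = 2 * 0 + a + (2 : ℕ) := by push_cast; ring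
  rw [h0, intervalIntegral.integral_comp_mul_add _ two_ne_zero, e, hn.integral_nat_mul]
  have h1 : ∫ x in (0 : ℝ)..2 * a, g x = ∫ x in (0 : ℝ)..2 * a, (1 : ℝ) := by
    refine intervalIntegral.integral_congr_Ioo_of_le (by linarith) fun x hx => ?_
    have : Int.fract x = x := Int.fract_eq_self.2 ⟨hx.1.le, by linarith [hx.2]⟩
    simp only [hg, this, if_pos hx.2]
  have h2 : ∫ x in (2 * a)..1, g x = ∫ x in (2 * a)..1, (0 : ℝ) := by
    refine intervalIntegral.integral_congr_Ioo_of_le (by linarith) fun x hx => ?_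
    have : Int.fract x = x := Int.fract_eq_self.2 ⟨by linarith [hx.1], hx.2⟩
    simp only [hg, this, if_neg (not_lt.2 hx.1.le)]
  rw [← intervalIntegral.integral_add_adjacent_intervals (hn.intervalIntegrable 0 (2 * a))
    (hn.intervalIntegrable (2 * a) 1), h1, h2]
  simp

end Branch

/-! ### The stopped random walk as a function on the line -/

section Walk

variable {B : Type*} [NormedAddCommGroup B]

/-- The mean of `‖s + ∑ ± v‖ ^ q` over all choices of signs, where `v` runs through the list. -/
noncomputable def signMean (q : ℝ) : List B → B → ℝ
  | [], s => ‖s‖ ^ q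
  | v :: l, s => (signMean q l (s + v) + signMean q l (s - v)) / 2

/-- The walk that starts at `s` and has the vectors of the list as steps, with signs `u(x)`,
`u(2 m x)`, `u((2 m) ^ 2 x)`, …, where `u` is `1` on `[0, 1 / 2)` and `-1` on `[1 / 2, 1)`, of
period `1`. It stops as soon as its position has norm larger than `c`. Its final position is a function
of the point `x`; its position after at most `k` steps is that of the walk for `l.take k`. -/
noncomputable def stoppedWalk (m : ℕ) (c : ℝ) : List B → B → ℝ → B
  | [], s => fun _ => s
  | v :: l, s => if c < ‖s‖ then fun _ => s
      else branch m (stoppedWalk m c l (s + v)) (stoppedWalk m c l (s - v))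

/-- The number of reasons why `x` is a bad point: the steps at which some `(2 m) ^ j x` is so close
to `ℤ / 2` that the sign may change near it, plus one if the walk stops before the last step. Only
the alternative `< 1` (that is, `= 0`) or `≥ 1` matters. -/
noncomputable def defect (m : ℕ) (c : ℝ) : List B → B → ℝ → ℝ
  | [], _ => fun _ => 0
  | v :: l, s => if c < ‖s‖ then fun _ => 1
      else fun x => nearHalfInteger (1 / (2 * m)) x +
        branch m (defect m c l (s + v)) (defect m c l (s - v)) x

lemma signMean_nonneg (q : ℝ) (l : List B) (s : B) : 0 ≤ signMean q l s := by
  induction l generalizing s with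
  | nil => exact Real.rpow_nonneg (norm_nonneg _) _
  | cons v l ih => exact div_nonneg (add_nonneg (ih _) (ih _)) zero_le_two

lemma isBoundedPeriodic_stoppedWalk (m : ℕ) (c : ℝ) (l : List B) (s : B) :
    IsBoundedPeriodic (stoppedWalk m c l s) := by
  induction l generalizing s with
  | nil => exact .const s
  | cons v l ih =>
    rw [stoppedWalk]
    split_ifs
    · exact .const s
    · exact (ih _).branch (ih _) m

lemma isBoundedPeriodic_defect (m : ℕ) (c : ℝ) (l : List B) (s : B) :
    IsBoundedPeriodic (defect m c l s) := by
  induction l generalizing s with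
  | nil => exact .const 0
  | cons v l ih =>
    rw [defect]
    split_ifs
    · exact .const 1
    · exact (isBoundedPeriodic_nearHalfInteger _).add ((ih _).branch (ih _) m)

lemma defect_nonneg (m : ℕ) (c : ℝ) (l : List B) (s : B) (x : ℝ) : 0 ≤ defect m c l s x := by
  induction l generalizing s x with
  | nil => exact le_rfl
  | cons v l ih =>
    rw [defect]
    split_ifs
    · exact zero_le_one
    · refine add_nonneg ?_ ?_
      · unfold nearHalfInteger; split_ifs <;> simp
      · unfold branch; split_ifs <;> exact ih _ _

/-- A walk stopped on leaving the ball of radius `c` overshoots by at most one step. -/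
lemma norm_stoppedWalk_le (m : ℕ) (c K : ℝ) {l : List B} (hl : ∀ v ∈ l, ‖v‖ ≤ K) {s : B}
    (hs : ‖s‖ ≤ c + K) (x : ℝ) : ‖stoppedWalk m c l s x‖ ≤ c + K := by
  induction l generalizing s x with
  | nil => exact hs
  | cons v l ih =>
    rw [stoppedWalk]
    split_ifs with h
    · exact hs
    · have hv := hl v List.mem_cons_self
      have hl' : ∀ w ∈ l, ‖w‖ ≤ K := fun w hw => hl w (List.mem_cons_of_mem _ hw)
      unfold branch
      split_ifs
      · exact ih hl' ((norm_add_le _ _).trans (add_le_add (not_lt.1 h) hv)) _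
      · exact ih hl' ((norm_sub_le _ _).trans (add_le_add (not_lt.1 h) hv)) _

lemma signMean_ofFn (q : ℝ) (n : ℕ) (x : Fin n → B) (s : B) :
    signMean q (List.ofFn x) s =
      (∑ ε : Fin n → ℤˣ, ‖s + ∑ k, (ε k : ℤ) • x k‖ ^ q) / 2 ^ n := by
  induction n generalizing s with
  | zero => simp [signMean]
  | succ n ih =>
    rw [List.ofFn_succ, signMean, ih, ih,
      ← (Fin.consEquiv fun _ : Fin (n + 1) => ℤˣ).sum_comp, Fintype.sum_prod_type]
    simp only [Fin.consEquiv_apply, Fin.sum_univ_succ, Fin.cons_zero, Fin.cons_succ]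
    have hu : (Finset.univ : Finset ℤˣ) = {1, -1} := rfl
    rw [hu, Finset.sum_pair (by decide)]
    simp only [Units.val_one, Units.val_neg, one_smul, neg_smul, ← add_assoc, ← sub_eq_add_neg]
    rw [pow_succ]
    ring

/-- Markov's inequality for `defect`. -/
lemma volume_defect_lt_one {m : ℕ} {c : ℝ} {l : List B}
    (h : ∫ x in (0 : ℝ)..1, defect m c l 0 x ≤ 1 / 2) :
    1 / 2 ≤ volume (Set.Ioc (0 : ℝ) 1 ∩ {x | defect m c l 0 x < 1}) := by
  set φ := defect m c l 0
  have hn : IsBoundedPeriodic φ := isBoundedPeriodic_defect _ _ _ _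
  have hms : MeasurableSet {x | φ x < 1} :=
    measurableSet_lt hn.stronglyMeasurable.measurable measurable_const
  set μ := volume.restrict (Set.Ioc (0 : ℝ) 1) with hμ
  have : IsProbabilityMeasure μ := ⟨by simp [hμ]⟩
  rw [intervalIntegral.integral_of_le zero_le_one] at h
  have h1 := mul_meas_ge_le_integral_of_nonneg (μ := μ) (f := φ)
    (ae_of_all _ (defect_nonneg m c l 0)) (hn.intervalIntegrable 0 1).1 1
  have h2 : {x | φ x < 1}ᶜ = {x | 1 ≤ φ x} := by ext; simp
  have h3 : μ.real {x | φ x < 1} = 1 - μ.real {x | 1 ≤ φ x} := by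
    rw [← h2, probReal_compl_eq_one_sub hms]; ring
  have h4 : 1 / 2 ≤ μ.real {x | φ x < 1} := by rw [h3]; linarith
  rw [Set.inter_comm, ← Measure.restrict_apply hms, ← hμ, ← ofReal_measureReal]
  refine le_trans (le_of_eq ?_) (ENNReal.ofReal_le_ofReal h4)
  rw [ENNReal.ofReal_div_of_pos two_pos]
  simp

lemma defect_cons_lt_one {m : ℕ} {c : ℝ} {v : B} {l : List B} {s : B} {x : ℝ}
    (h : defect m c (v :: l) s x < 1) :
    ¬ c < ‖s‖ ∧ 2 * (1 / (2 * m : ℝ)) ≤ Int.fract (2 * x + 1 / (2 * m)) ∧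
      branch m (defect m c l (s + v)) (defect m c l (s - v)) x < 1 := by
  have hb : 0 ≤ branch m (defect m c l (s + v)) (defect m c l (s - v)) x := by
    unfold branch; split_ifs <;> exact defect_nonneg _ _ _ _ _
  rw [defect] at h
  split_ifs at h with h1
  · exact absurd h (lt_irrefl _)
  · refine ⟨h1, ?_⟩
    simp only [nearHalfInteger] at h
    split_ifs at h with h2
    · linarith
    · exact ⟨not_lt.1 h2, by linarith⟩

lemma norm_stoppedWalk_take_sub {m : ℕ} {c : ℝ} {l : List B} {s : B} {k : ℕ} (hk : k < l.length)
    {x : ℝ} (hx : defect m c l s x < 1) :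
    ‖stoppedWalk m c (l.take k) s x - stoppedWalk m c (l.take (k + 1)) s x‖ = ‖l[k]‖ := by
  induction l generalizing k s x with
  | nil => simp at hk
  | cons v l ih =>
    obtain ⟨h1, -, h3⟩ := defect_cons_lt_one hx
    cases k with
    | zero =>
      simp only [List.take_zero, List.take_succ_cons, stoppedWalk, if_neg h1, branch]
      split_ifs <;> simp
    | succ k =>
      simp only [List.take_succ_cons, stoppedWalk, if_neg h1, branch,
        List.getElem_cons_succ] at h3 ⊢
      split_ifs at h3 ⊢ <;> exact ih (by simpa using hk) h3

variable [NormedSpace ℝ B]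

/-- Convexity of `‖·‖ ^ q` at the midpoint `d` of `a` and `b`. -/
lemma norm_rpow_le_mean {q : ℝ} (hq : 1 ≤ q) {a b d : B} (h : d + d = a + b) :
    ‖d‖ ^ q ≤ (‖a‖ ^ q + ‖b‖ ^ q) / 2 := by
  have h1 : ‖d‖ ≤ 1 / 2 * ‖a‖ + 1 / 2 * ‖b‖ := by
    have h2 : ‖d + d‖ = 2 * ‖d‖ := by rw [← two_smul ℝ d, norm_smul]; simp
    have := norm_add_le a b
    rw [← h, h2] at this
    linarith
  calc ‖d‖ ^ q ≤ (1 / 2 * ‖a‖ + 1 / 2 * ‖b‖) ^ q :=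
        Real.rpow_le_rpow (norm_nonneg _) h1 (by linarith)
    _ ≤ 1 / 2 * ‖a‖ ^ q + 1 / 2 * ‖b‖ ^ q :=
        (convexOn_rpow hq).2 (norm_nonneg a) (norm_nonneg b) (by norm_num) (by norm_num)
          (by norm_num)
    _ = _ := by ring

/-- Jensen's inequality: the walk is a martingale, so `‖·‖ ^ q` along it is a submartingale. -/
lemma norm_rpow_le_signMean {q : ℝ} (hq : 1 ≤ q) (l : List B) (s : B) :
    ‖s‖ ^ q ≤ signMean q l s := by
  induction l generalizing s with
  | nil => exact le_rfl
  | cons v l ih =>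
    have := norm_rpow_le_mean hq (show s + s = (s + v) + (s - v) by abel)
    simp only [signMean]
    linarith [ih (s + v), ih (s - v)]

lemma norm_rpow_le_signMean_of_mem {q : ℝ} (hq : 1 ≤ q) {l : List B} {w : B} (hw : w ∈ l) (s : B) :
    ‖w‖ ^ q ≤ signMean q l s := by
  induction l generalizing s with
  | nil => simp at hw
  | cons v l ih =>
    simp only [signMean]
    rcases List.mem_cons.1 hw with rfl | hw
    · have := norm_rpow_le_mean hq (show w + w = (s + w) + -(s - w) by abel)
      rw [norm_neg] at this
      linarith [norm_rpow_le_signMean hq l (s + w), norm_rpow_le_signMean hq l (s - w)]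
    · linarith [ih hw (s + v), ih hw (s - v)]

/-- The stopped walk is a martingale, so its mean is its starting point. -/
lemma integral_stoppedWalk [CompleteSpace B] {m : ℕ} (hm : 0 < m) (c : ℝ) (l : List B) (s : B) :
    ∫ x in (0 : ℝ)..1, stoppedWalk m c l s x = s := by
  induction l generalizing s with
  | nil => simp [stoppedWalk]
  | cons v l ih =>
    rw [stoppedWalk]
    split_ifs
    · simp
    · rw [(isBoundedPeriodic_stoppedWalk _ _ _ _).integral_branch
        (isBoundedPeriodic_stoppedWalk _ _ _ _) hm, ih, ih,
        add_add_sub_cancel, ← two_smul ℝ s, smul_smul]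
      norm_num

/-- The first term on the right is the bound of Doob's maximal inequality for the probability that
the walk stops; in the second, each scale contributes the measure `1 / m` of the points close to
`ℤ / 2`. -/
lemma integral_defect_le {m : ℕ} (hm : 0 < m) {c q : ℝ} (hc : 0 < c) (hq : 1 ≤ q) (l : List B)
    (s : B) : ∫ x in (0 : ℝ)..1, defect m c l s x ≤ signMean q l s / c ^ q + l.length / m := by
  have hcq : 0 < c ^ q := Real.rpow_pos_of_pos hc q
  have hm1 : (1 : ℝ) ≤ m := by exact_mod_cast hm
  induction l generalizing s with
  | nil => simpa [defect] using div_nonneg (signMean_nonneg q [] s) hcq.le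
  | cons v l ih =>
    rw [defect]
    split_ifs with h
    · have h1 : 1 ≤ signMean q (v :: l) s / c ^ q := by
        rw [one_le_div hcq]
        exact (Real.rpow_le_rpow hc.le h.le (by linarith)).trans (norm_rpow_le_signMean hq _ _)
      have h2 : (0 : ℝ) ≤ (v :: l).length / m := by positivity
      simp only [intervalIntegral.integral_const, sub_zero, smul_eq_mul, mul_one]
      linarith
    · have hn := (isBoundedPeriodic_defect m c l (s + v)).branch
        (isBoundedPeriodic_defect m c l (s - v)) m
      rw [intervalIntegral.integral_add
        ((isBoundedPeriodic_nearHalfInteger _).intervalIntegrable _ _) (hn.intervalIntegrable _ _), (isBoundedPeriodic_defect _ _ _ _).integral_branch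
        (isBoundedPeriodic_defect _ _ _ _) hm, integral_nearHalfInteger (by positivity)
        (by rw [← mul_div_assoc, div_le_one (by positivity)]; linarith)]
      have h1 := ih (s + v)
      have h2 := ih (s - v)
      have e : signMean q (v :: l) s / c ^ q =
          (signMean q l (s + v) / c ^ q + signMean q l (s - v) / c ^ q) / 2 := by
        rw [signMean]; ring
      have e2 : ((v :: l).length : ℝ) / m = l.length / m + 1 / m := by
        rw [List.length_cons]; push_cast; ring
      have e3 : (2 : ℝ) * (1 / (2 * m)) = 1 / m := by field_simp
      rw [e, e2, e3, smul_eq_mul]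
      linarith

/-- At a good point, averaging over the window of length `(2 m) ^ (-k)` centred there gives exactly
the walk after `k` steps: the first `k` signs are constant on the window, and the window is a full
period of the walk that remains. -/
lemma integral_stoppedWalk_window [CompleteSpace B] {m : ℕ} (hm : 0 < m) (c : ℝ) (l : List B)
    (s : B) (k : ℕ) (x : ℝ) (hx : defect m c l s x < 1) :
    ∫ y in x - 1 / (2 * (2 * m) ^ k)..x + 1 / (2 * (2 * m) ^ k), stoppedWalk m c l s y =
      (1 / (2 * m) ^ k : ℝ) • stoppedWalk m c (l.take k) s x := by
  have hm1 : (1 : ℝ) ≤ m := by exact_mod_cast hm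
  have hm0 : (2 * m : ℝ) ≠ 0 := by positivity
  have hconst : ∀ k : ℕ, ∫ _ in x - 1 / (2 * (2 * m) ^ k)..x + 1 / (2 * (2 * m) ^ k), s =
      (1 / (2 * m) ^ k : ℝ) • s := fun k => by
    rw [intervalIntegral.integral_const]
    congr 1
    field_simp
    ring
  induction k generalizing l s x with
  | zero =>
    have e : x + 1 / (2 * (2 * m) ^ 0) = x - 1 / (2 * (2 * m) ^ 0) + (1 : ℕ) := by
      simp; ring
    rw [e, (isBoundedPeriodic_stoppedWalk _ _ _ _).integral_nat_mul, integral_stoppedWalk hm]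
    simp [stoppedWalk]
  | succ k ih =>
    cases l with
    | nil => exact hconst _
    | cons v l =>
      obtain ⟨h1, h2, h3⟩ := defect_cons_lt_one hx
      rw [List.take_succ_cons, stoppedWalk, stoppedWalk, if_neg h1, if_neg h1]
      set r : ℝ := 1 / (2 * (2 * m) ^ (k + 1)) with hr
      have hr0 : 0 ≤ r := by positivity
      have hra : r ≤ 1 / (2 * m) / 2 := by
        rw [hr, div_div, mul_comm (2 * m : ℝ) 2]
        refine one_div_le_one_div_of_le (by positivity) ?_
        have : (1 : ℝ) ≤ (2 * m) ^ k := one_le_pow₀ (by linarith)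
        rw [pow_succ]
        nlinarith
      have hr' : 2 * m * r = 1 / (2 * (2 * m) ^ k) := by
        rw [hr, pow_succ]; field_simp
      have key : ∀ w : B, defect m c l w (2 * m * x) < 1 →
          ∫ y in x - r..x + r, stoppedWalk m c l w (2 * m * y) =
            (1 / (2 * m) ^ (k + 1) : ℝ) • stoppedWalk m c (l.take k) w (2 * m * x) := by
        intro w hw
        have := ih l w (2 * m * x) hw ?_
        · rw [intervalIntegral.integral_comp_mul_left _ hm0, mul_sub, mul_add, hr', this, smul_smul]
          congr 1
          rw [pow_succ]
          field_simp
        · intro k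
          rw [intervalIntegral.integral_const]
          congr 1
          field_simp
          ring
      have hloc : ∀ y ∈ Set.uIcc (x - r) (x + r), Int.fract y < 1 / 2 ↔ Int.fract x < 1 / 2 := by
        intro y hy
        rw [Set.uIcc_of_le (by linarith)] at hy
        exact fract_lt_half_congr h2 ((abs_le.2 ⟨by linarith [hy.1], by linarith [hy.2]⟩).trans hra)
      by_cases hf : Int.fract x < 1 / 2
      · simp only [branch, if_pos hf] at h3 ⊢
        rw [← key _ h3]
        exact intervalIntegral.integral_congr fun y hy => if_pos ((hloc y hy).2 hf)
      · simp only [branch, if_neg hf] at h3 ⊢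
        rw [← key _ h3]
        exact intervalIntegral.integral_congr fun y hy => if_neg (mt (hloc y hy).1 hf)

end Walk

/-! ### From averages to variation -/

lemma intervalAvg_eq_intervalIntegral {B : Type*} [NormedAddCommGroup B] [NormedSpace ℝ B]
    (f : ℝ → B) {t : ℝ} (ht : 0 < t) (x : ℝ) :
    intervalAvg f t x = (1 / (2 * t)) • ∫ y in x - t..x + t, f y := by
  have h : ∫ y in x - t..x + t, f y = ∫ y in -t..t, f (x + y) := by
    rw [intervalIntegral.integral_comp_add_left]
    simp [sub_eq_add_neg]
  rw [h, intervalAvg, setAverage_eq, Real.ball_eq_Ioo, zero_sub, zero_add,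
    intervalIntegral.integral_of_le (by linarith), integral_Ioc_eq_integral_Ioo,
    Real.volume_real_Ioo_of_le (by linarith)]
  congr 1
  rw [one_div]
  congr 1
  ring

section Variation

variable {B : Type*} [NormedAddCommGroup B] [NormedSpace ℝ B] [CompleteSpace B]

/-- The cutoff to `[-1, 2]`, which brings the walk into `L ^ p`, is not seen by the averages at
points of `(0, 1]` and scales at most `1`. -/
lemma intervalAvg_indicator_stoppedWalk {m : ℕ} (hm : 0 < m) (c : ℝ) (l : List B) (k : ℕ) {x : ℝ}
    (hx : x ∈ Set.Ioc (0 : ℝ) 1) (hd : defect m c l 0 x < 1) :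
    intervalAvg ((Set.Icc (-1 : ℝ) 2).indicator (stoppedWalk m c l 0)) (1 / (2 * (2 * m) ^ k)) x =
      stoppedWalk m c (l.take k) 0 x := by
  have hm1 : (1 : ℝ) ≤ m := by exact_mod_cast hm
  have hpow : (1 : ℝ) ≤ (2 * m) ^ k := one_le_pow₀ (by linarith)
  have ht1 : 1 / (2 * (2 * m) ^ k : ℝ) ≤ 1 := by
    rw [div_le_one (by positivity)]; linarith
  have ht0 : 0 < 1 / (2 * (2 * m) ^ k : ℝ) := by positivity
  rw [intervalAvg_eq_intervalIntegral _ ht0]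
  rw [intervalIntegral.integral_congr (g := stoppedWalk m c l 0),
    integral_stoppedWalk_window hm c l 0 k x hd, smul_smul]
  · convert one_smul ℝ _ using 2
    field_simp
  · intro y hy
    rw [Set.uIcc_of_le (by linarith)] at hy
    have hy' : y ∈ Set.Icc (-1 : ℝ) 2 := ⟨by linarith [hy.1, hx.1], by linarith [hy.2, hx.2]⟩
    exact Set.indicator_of_mem hy' _

lemma sum_le_qVariation_stoppedWalk {m : ℕ} (hm : 0 < m) (c : ℝ) {q : ℝ} (hq : 0 < q) {n : ℕ}
    (v : Fin n → B) {x : ℝ} (hx : x ∈ Set.Ioc (0 : ℝ) 1)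
    (hd : defect m c (List.ofFn v) 0 x < 1) :
    ENNReal.ofReal ((∑ k, ‖v k‖ ^ q) ^ (1 / q)) ≤ qVariation q (fun t => intervalAvg
      ((Set.Icc (-1 : ℝ) 2).indicator (stoppedWalk m c (List.ofFn v) 0)) t x) := by
  have hm1 : (1 : ℝ) ≤ m := by exact_mod_cast hm
  rw [← ENNReal.ofReal_rpow_of_nonneg (Finset.sum_nonneg fun k _ => by positivity) (by positivity),
    ENNReal.ofReal_sum_of_nonneg (fun k _ => by positivity)]
  -- The radii run backwards through the scales `(2 m) ^ (-k)`; truncated subtraction keeps them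
  -- constant from index `n` on.
  have hmono : Monotone fun i : ℕ => 1 / (2 * (2 * m : ℝ) ^ (n - i)) := fun i j hij => by
    refine one_div_le_one_div_of_le (by positivity) ?_
    have : (2 * m : ℝ) ^ (n - j) ≤ (2 * m) ^ (n - i) :=
      pow_le_pow_right₀ (by linarith) (by omega)
    linarith
  refine le_trans ?_ (le_iSup_of_le _ (le_iSup₂_of_le hmono (fun i => by positivity) le_rfl))
  refine ENNReal.rpow_le_rpow (le_add_left ?_) (by positivity)
  refine le_trans ?_ (ENNReal.sum_le_tsum (Finset.range n))
  rw [← Fin.sum_univ_eq_sum_range, ← Equiv.sum_comp Fin.revPerm]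
  refine Finset.sum_le_sum fun k _ => ?_
  beta_reduce
  rw [intervalAvg_indicator_stoppedWalk hm c _ _ hx hd,
    intervalAvg_indicator_stoppedWalk hm c _ _ hx hd]
  have e : n - (k : ℕ) = n - (k + 1) + 1 := by omega
  have hlt : n - ((k : ℕ) + 1) < (List.ofFn v).length := by rw [List.length_ofFn]; omega
  have := norm_stoppedWalk_take_sub hlt hd
  rw [e, ← ofReal_norm, this, ENNReal.ofReal_rpow_of_nonneg (norm_nonneg _) hq.le,
    List.getElem_ofFn]
  exact le_rfl

/-- Here `E` is the `L ^ q` norm of `∑ ε_k v_k`. -/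
lemma sum_le_of_eLpNorm_qVariation_le {q : ℝ} (hq : 2 ≤ q) {p : ℝ} (hp : 1 < p) {C : ℝ≥0}
    (hC : ∀ f : ℝ → B, MemLp f (ENNReal.ofReal p) volume →
      eLpNorm (fun x => qVariation q (fun t => intervalAvg f t x)) (ENNReal.ofReal p) volume ≤
        C * eLpNorm f (ENNReal.ofReal p) volume)
    {n : ℕ} (v : Fin n → B) {E : ℝ} (hE : 0 < E) (hEq : signMean q (List.ofFn v) 0 = E ^ q) :
    (∑ k, ‖v k‖ ^ q) ^ (1 / q) ≤ 18 * C * E := by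
  set l := List.ofFn v with hl
  -- With this `m`, the `n` scales together lose measure at most `n / m ≤ 1 / 4`.
  set m := 4 * n + 4 with hmdef
  have hm : 0 < m := by omega
  -- With this `c`, the walk stops with probability at most `2 ^ (-q) ≤ 1 / 4`.
  set c := 2 * E with hcdef
  set Q := (∑ k, ‖v k‖ ^ q) ^ (1 / q)
  have hQ : 0 ≤ Q := by positivity
  have hp0 : ENNReal.ofReal p ≠ 0 := by simp; linarith
  have hp_top : ENNReal.ofReal p ≠ ∞ := ENNReal.ofReal_ne_top
  have hpr : (ENNReal.ofReal p).toReal = p := ENNReal.toReal_ofReal (by linarith)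
  have hvE : ∀ w ∈ l, ‖w‖ ≤ E := fun w hw =>
    (Real.rpow_le_rpow_iff (norm_nonneg _) hE.le (by linarith)).1
      (hEq ▸ norm_rpow_le_signMean_of_mem (by linarith) hw 0)
  have hbound : ∀ x, ‖stoppedWalk m c l 0 x‖ ≤ 3 * E := fun x =>
    (norm_stoppedWalk_le m c E hvE (by simp; positivity) x).trans (by linarith)
  have hdef : ∫ x in (0 : ℝ)..1, defect m c l 0 x ≤ 1 / 2 := by
    refine (integral_defect_le hm (by positivity : 0 < c) (by linarith : 1 ≤ q) l 0).trans ?_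
    have h1 : signMean q l 0 / c ^ q ≤ 1 / 4 := by
      rw [hEq, hcdef, Real.mul_rpow zero_le_two hE.le]
      have : (4 : ℝ) ≤ 2 ^ q := by
        calc (4 : ℝ) = 2 ^ (2 : ℝ) := by norm_num
          _ ≤ 2 ^ q := Real.rpow_le_rpow_of_exponent_le one_le_two hq
      have hEp := Real.rpow_pos_of_pos hE q
      rw [div_le_div_iff₀ (by positivity) (by norm_num)]
      nlinarith
    have h2 : (l.length : ℝ) / m ≤ 1 / 4 := by
      rw [hl, List.length_ofFn, hmdef]
      push_cast
      rw [div_le_div_iff₀ (by positivity) (by norm_num)]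
      linarith
    linarith
  set f := (Set.Icc (-1 : ℝ) 2).indicator (stoppedWalk m c l 0)
  have hfle : ∀ x, ‖f x‖ ≤ ‖(Set.Icc (-1 : ℝ) 2).indicator (fun _ => 3 * E) x‖ := by
    intro x
    by_cases hx : x ∈ Set.Icc (-1 : ℝ) 2
    · simp only [f]
      rw [Set.indicator_of_mem hx, Set.indicator_of_mem hx]
      exact (hbound x).trans (le_abs_self _)
    · simp only [f]
      rw [Set.indicator_of_notMem hx, Set.indicator_of_notMem hx]
      simp
  have hvol : volume (Set.Icc (-1 : ℝ) 2) = 3 := by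
    rw [Real.volume_Icc]; norm_num
  have hconst : MemLp ((Set.Icc (-1 : ℝ) 2).indicator (fun _ => 3 * E)) (ENNReal.ofReal p)
      volume := memLp_indicator_const _ measurableSet_Icc _ (Or.inr (by simp [hvol]))
  have hfm : MemLp f (ENNReal.ofReal p) volume := hconst.mono
    ((isBoundedPeriodic_stoppedWalk m c l 0).stronglyMeasurable.indicator
      measurableSet_Icc).aestronglyMeasurable (ae_of_all _ hfle)
  have hinv : 1 / p ≤ 1 := by rw [div_le_one (by linarith)]; exact hp.le
  have hfn : eLpNorm f (ENNReal.ofReal p) volume ≤ ENNReal.ofReal (9 * E) := by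
    refine (eLpNorm_mono hfle).trans ?_
    rw [eLpNorm_indicator_const measurableSet_Icc hp0 hp_top, hpr, hvol, Real.enorm_eq_ofReal
      (by positivity)]
    calc ENNReal.ofReal (3 * E) * 3 ^ (1 / p) ≤ ENNReal.ofReal (3 * E) * 3 ^ (1 : ℝ) := by
          gcongr
          norm_num
      _ = ENNReal.ofReal (9 * E) := by
          rw [ENNReal.rpow_one, show (3 : ℝ≥0∞) = ENNReal.ofReal 3 by simp,
            ← ENNReal.ofReal_mul (by positivity)]
          congr 1
          ring
  set G := Set.Ioc (0 : ℝ) 1 ∩ {x | defect m c l 0 x < 1} with hG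
  have hGm : MeasurableSet G := measurableSet_Ioc.inter
    (measurableSet_lt (isBoundedPeriodic_defect m c l 0).stronglyMeasurable.measurable
      measurable_const)
  -- On `G` the variation is at least `Q`, and `G` has measure at least `1 / 2`.
  have hlow : ENNReal.ofReal Q * (1 / 2) ≤
      eLpNorm (fun x => qVariation q (fun t => intervalAvg f t x)) (ENNReal.ofReal p) volume := by
    calc ENNReal.ofReal Q * (1 / 2) ≤ ENNReal.ofReal Q * volume G ^ (1 / p) := by
          gcongr
          calc (1 / 2 : ℝ≥0∞) = (1 / 2) ^ (1 : ℝ) := by simp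
            _ ≤ (1 / 2) ^ (1 / p) :=
              ENNReal.rpow_le_rpow_of_exponent_ge (by simp) hinv
            _ ≤ _ := ENNReal.rpow_le_rpow (volume_defect_lt_one hdef) (by positivity)
      _ = eLpNorm (G.indicator fun _ => Q) (ENNReal.ofReal p) volume := by
          rw [eLpNorm_indicator_const hGm hp0 hp_top, hpr, Real.enorm_eq_ofReal hQ]
      _ ≤ _ := by
          refine eLpNorm_mono_enorm fun x => ?_
          by_cases hx : x ∈ G
          · rw [Set.indicator_of_mem hx, Real.enorm_eq_ofReal hQ]
            exact sum_le_qVariation_stoppedWalk hm c (by linarith) v hx.1 hx.2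
          · simp [Set.indicator_of_notMem hx]
  have hfin := hlow.trans ((hC f hfm).trans (mul_le_mul_right hfn C))
  have e1 : ENNReal.ofReal Q * (1 / 2) = ENNReal.ofReal (Q * (1 / 2)) := by
    rw [ENNReal.ofReal_mul hQ, ENNReal.ofReal_div_of_pos two_pos]; simp
  have e2 : (C : ℝ≥0∞) * ENNReal.ofReal (9 * E) = ENNReal.ofReal (C * (9 * E)) := by
    rw [ENNReal.ofReal_mul C.coe_nonneg, ENNReal.ofReal_coe_nnreal]
  rw [e1, e2, ENNReal.ofReal_le_ofReal_iff (by positivity)] at hfin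
  linarith

end Variation

theorem mainTheorem6 {B : Type*} [NormedAddCommGroup B] [NormedSpace ℝ B] [CompleteSpace B]
    (q : ℝ) (hq : 2 ≤ q)
    (h : ∃ p : ℝ, 1 < p ∧ ∃ C : ℝ≥0, ∀ f : ℝ → B, MemLp f (ENNReal.ofReal p) volume →
      eLpNorm (fun x => qVariation q (fun t => intervalAvg f t x)) (ENNReal.ofReal p) volume ≤
        C * eLpNorm f (ENNReal.ofReal p) volume) :
    HasRademacherCotype B q := by
  obtain ⟨p, hp, C, hC⟩ := h
  refine ⟨18 * C, fun n v => ?_⟩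
  have hq0 : 0 < q := by linarith
  have hs := signMean_ofFn q n v 0
  simp only [zero_add] at hs
  rw [← hs]
  set S := signMean q (List.ofFn v) 0
  rcases (signMean_nonneg q (List.ofFn v) 0).eq_or_lt with h0 | h0
  -- If the mean vanishes, then so do all the vectors.
  · have hv : ∀ k, ‖v k‖ ^ q = 0 := fun k => le_antisymm
      (h0 ▸ norm_rpow_le_signMean_of_mem (by linarith) (List.mem_ofFn.2 ⟨k, rfl⟩) 0)
      (by positivity)
    simp only [hv, Finset.sum_const_zero]
    rw [Real.zero_rpow (by positivity)]
    positivity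
  · refine sum_le_of_eLpNorm_qVariation_le hq hp hC v (Real.rpow_pos_of_pos h0 _) ?_
    rw [← Real.rpow_mul h0.le, one_div_mul_cancel hq0.ne', Real.rpow_one]
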